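/- A directed multigraph consists of a finite set of vertices and a finite set of directed edges, parallel edges being allowed; it is \emph{3-regular} if $\mathrm{indeg}(v)+\mathrm{outdeg}(v)=3$ for every vertex $v$, \emph{simple} if it has no loops and no two distinct edges with the same pair of endpoints, and \emph{$k$-edge connected} if its underlying undirected multigraph stays connected after the deletion of any fewer than $k$ edges. Let $\mathcal{G}$ be the class of 3-regular acyclic (not necessarily simple) directed multigraphs with a unique source and a unique sink. For $D\in\mathcal{G}$ with source $s$, let $\mu_D(v)$ be the number of directed paths from $s$ to $v$, where paths that use different parallel edges are different. (1) Let $D\in\mathcal{G}$ have vertex set $V$, $|V|=N$, source $s$ and sink $t$. Then there are an ordering $y_1,\dots,y_N$ of $V$ such that every edge of $D$ goes from some $y_i$ to some $y_j$ with $i<j$ and $\mu_D(y_1)\le\dots\le\mu_D(y_N)$, and a graph $D'\in\mathcal{G}$ on the same vertex set $V$, with the same number of edges and the same source $s$ and sink $t$, such that every edge of $D'$ also goes from some $y_i$ to some $y_j$ with $i<j$, the sequence $y_1,y_2,\dots,y_N$ is a directed Hamiltonian path of $D'$, and \[\mu_D(v)\le\mu_{D'}(v)\qquad\text{for all } v\in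 V.\] Furthermore, if $D$ is simple, then so is $D'$; if $D$ is 2-edge connected, then so is $D'$; and if $D$ is 3-edge connected, then so is $D'$. (2) Consequently, let $k\in\{1,2,3\}$ and $N\ge 1$, and consider the graphs in $\mathcal{G}$ on $N$ vertices that are $k$-edge connected or, alternatively, those that are $k$-edge connected and simple. If there is any such graph, then the maximum number of source-to-sink paths over all such graphs exists and is attained by one that has a directed Hamiltonian path. In particular, among all 3-regular, 3-edge connected acyclic directed multigraphs with a unique source and a unique sink on a given number of vertices, the number of source-to-sink paths is maximized by one with a directed Hamiltonian path. -/

import Mathlib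

universe u v

/-- A directed multigraph with vertex set `V` and edge set `E`; every edge `e` is directed from
`src e` to `tgt e`. Parallel edges are allowed. -/
structure DiMultigraph (V : Type u) (E : Type v) where
  src : E → V
  tgt : E → V

namespace DiMultigraph

variable {V : Type u} {E : Type v}

/-- The number of edges starting at `x`. -/
noncomputable def outdeg (D : DiMultigraph V E) (x : V) : ℕ := {e : E | D.src e = x}.ncard

/-- The number of edges ending at `x`. -/
noncomputable def indeg (D : DiMultigraph V E) (x : V) : ℕ := {e : E | D.tgt e = x}.ncard

/-- `D.IsPath x l y`: the list `l` of edges is a directed path from `x` to `y`. In an acyclic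
graph no vertex can be repeated along such a sequence of edges. -/
def IsPath (D : DiMultigraph V E) : V → List E → V → Prop
  | x, [], y => x = y
  | x, e :: l, y => D.src e = x ∧ D.IsPath (D.tgt e) l y

/-- The number of directed paths from `x` to `y`. -/
noncomputable def numPaths (D : DiMultigraph V E) (x y : V) : ℕ∞ := {l : List E | D.IsPath x l y}.encard

/-- Every vertex is incident to exactly three edges. -/
def IsThreeRegular (D : DiMultigraph V E) : Prop := ∀ x, D.indeg x + D.outdeg x = 3

/-- There is no directed cycle. -/
def IsAcyclic (D : DiMultigraph V E) : Prop := ∀ x l, D.IsPath x l x → l = []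

/-- `s` is a source, and the only one. -/
def IsUniqueSource (D : DiMultigraph V E) (s : V) : Prop := ∀ x, D.indeg x = 0 ↔ x = s

/-- `t` is a sink, and the only one. -/
def IsUniqueSink (D : DiMultigraph V E) (t : V) : Prop := ∀ x, D.outdeg x = 0 ↔ x = t

/-- A 3-regular acyclic directed multigraph with unique source `s` and unique sink `t`. -/
structure IsCubicDag (D : DiMultigraph V E) (s t : V) : Prop where
  threeRegular : D.IsThreeRegular
  acyclic : D.IsAcyclic
  source : D.IsUniqueSource s
  sink : D.IsUniqueSink t

/-- No loops, and no two distinct edges with the same two endpoints. -/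
def IsSimple (D : DiMultigraph V E) : Prop :=
  (∀ e, D.src e ≠ D.tgt e) ∧ Function.Injective fun e => s(D.src e, D.tgt e)

/-- Adjacency in the underlying undirected graph after the edges in `F` have been deleted. -/
def underlyingDelete (D : DiMultigraph V E) (F : Finset E) : SimpleGraph V :=
  SimpleGraph.fromRel fun x y => ∃ e, e ∉ F ∧ D.src e = x ∧ D.tgt e = y

/-- `k`-edge connectivity: after the deletion of any fewer than `k` edges, the underlying
undirected graph is connected. -/
def EdgeConnected (D : DiMultigraph V E) (k : ℕ) : Prop :=
  ∀ F : Finset E, F.card < k → (D.underlyingDelete F).Connected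

/-- The total order `y 0, y 1, …` on the vertices respects the orientation of the edges. -/
def IsTopologicalOrder [Fintype V] (D : DiMultigraph V E) (y : Fin (Fintype.card V) ≃ V) : Prop :=
  ∀ e, y.symm (D.src e) < y.symm (D.tgt e)

/-- The sequence `y 0, y 1, …`, in which every vertex occurs exactly once, is the vertex sequence
of a directed path. -/
def IsHamiltonianPath [Fintype V] (D : DiMultigraph V E) (y : Fin (Fintype.card V) ≃ V) : Prop :=
  ∀ i j : Fin (Fintype.card V), i.val + 1 = j.val → ∃ e, D.src e = y i ∧ D.tgt e = y j

/-- Membership in the class of 3-regular acyclic directed multigraphs with unique source `s` and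
unique sink `t` that are `k`-edge connected and, if `simple` is `true`, simple. -/
def InClass (k : ℕ) (simple : Bool) (D : DiMultigraph V E) (s t : V) : Prop :=
  D.IsCubicDag s t ∧ D.EdgeConnected k ∧ (simple = true → D.IsSimple)

end DiMultigraph

/-! Order the vertices by path count μ, with edges pointing forward, and treat consecutive pairs u,
v from the sink downwards. If no edge joins u to v, take edges f : a → v and g : u → w and exchange
their sources, giving u → v and a → w. Degrees and the order survive. Since μ(a) ≤ μ(u), v gains at
least δ = μ(u) - μ(a) paths. The vertex w loses δ through g, but the Hamiltonian tail already built
from v to w carries the gain there, so no count drops (`IsExchange.pathCount_add_le`).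

Once the Hamiltonian path exists, a cut separating s from t either is a prefix cut, whose size no
exchange alters, or meets the path three times (`IsCubicDag.le_ncard_cut`). The only other danger is
a set avoiding s and t with one edge in and one out. If u has a second outgoing edge, taking g with
the earliest head prevents it. Otherwise the tie-breaking in `IsCubicDag.exists_order` gives v two
incoming edges, and one of them is a good f (`IsExchange.noThinSet_or_noThinSet`). An old edge a → w
would spoil simplicity, but the degree of w keeps a suitable choice available.

For the second claim, apply this improvement to a maximizer among the finitely many graphs on fixed
vertex and edge types. -/

namespace DiMultigraph

/-! ### Directed paths and the recursion for their number. -/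

section Paths

variable {V : Type u} {E : Type v} {D : DiMultigraph V E}

theorem isPath_append {l₁ l₂ : List E} {x y : V} :
    D.IsPath x (l₁ ++ l₂) y ↔ ∃ z, D.IsPath x l₁ z ∧ D.IsPath z l₂ y := by
  induction l₁ generalizing x with
  | nil => simp [IsPath]
  | cons e l ih => simp [IsPath, ih, and_assoc]

theorem isPath_concat {l : List E} {e : E} {x y : V} :
    D.IsPath x (l ++ [e]) y ↔ D.IsPath x l (D.src e) ∧ D.tgt e = y := by
  simp [isPath_append, IsPath]

/-- Split paths by their last edge; the empty path accounts for the extra 1 at `s`. -/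
theorem numPaths_eq_add_sum [DecidableEq V] [Fintype E] (D : DiMultigraph V E) (s x : V) :
    D.numPaths s x = (if x = s then 1 else 0) + ∑ e with D.tgt e = x, D.numPaths s (D.src e) := by
  have hset : {l : List E | D.IsPath s l x} = {l | l = [] ∧ x = s} ∪
      ⋃ e, {l | D.tgt e = x ∧ ∃ l', D.IsPath s l' (D.src e) ∧ l' ++ [e] = l} := by
    ext l
    rcases List.eq_nil_or_concat l with rfl | ⟨l', e, rfl⟩
    · simpa [IsPath] using eq_comm
    · simp [isPath_concat, and_comm]
  have hdisj : Disjoint {l : List E | l = [] ∧ x = s}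
      (⋃ e, {l | D.tgt e = x ∧ ∃ l', D.IsPath s l' (D.src e) ∧ l' ++ [e] = l}) := by
    rw [Set.disjoint_left]
    rintro l ⟨rfl, -⟩ h
    simp at h
  have hpair : Pairwise (Function.onFun Disjoint fun e =>
      {l | D.tgt e = x ∧ ∃ l', D.IsPath s l' (D.src e) ∧ l' ++ [e] = l}) := by
    intro e e' hne
    rw [Function.onFun, Set.disjoint_left]
    rintro l ⟨-, l', -, rfl⟩ ⟨-, l'', -, h⟩
    exact hne (by simpa using ((List.append_inj' h rfl).2).symm)
  rw [numPaths, hset, Set.encard_union_eq hdisj, Set.encard_iUnion_of_finite hpair,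
    finsum_eq_sum_of_fintype, Finset.sum_filter]
  congr 1
  · by_cases h : x = s <;> simp [h]
  · refine Finset.sum_congr rfl fun e _ => ?_
    by_cases h : D.tgt e = x
    · have : {l | D.tgt e = x ∧ ∃ l', D.IsPath s l' (D.src e) ∧ l' ++ [e] = l} =
          (fun l' => l' ++ [e]) '' {l | D.IsPath s l (D.src e)} := by
        ext l; simp [h]
      rw [this, (List.append_left_injective [e]).encard_image, if_pos h, numPaths]
    · simp [h]

theorem IsAcyclic.exists_linearOrder (h : D.IsAcyclic) :
    ∃ _ : LinearOrder V, ∀ e, D.src e < D.tgt e := by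
  let P : PartialOrder V :=
    { le := fun x y => ∃ l, D.IsPath x l y
      le_refl := fun x => ⟨[], rfl⟩
      le_trans := fun x y z ⟨l, hl⟩ ⟨l', hl'⟩ => ⟨l ++ l', isPath_append.2 ⟨y, hl, hl'⟩⟩
      le_antisymm := by
        rintro x y ⟨l, hl⟩ ⟨l', hl'⟩
        have := h x (l ++ l') (isPath_append.2 ⟨y, hl, hl'⟩)
        obtain ⟨rfl, rfl⟩ := List.append_eq_nil_iff.1 this
        exact hl }
  refine ⟨(inferInstance : LinearOrder (LinearExtension V)), fun e => ?_⟩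
  refine lt_of_le_of_ne
    ((toLinearExtension (α := V)).monotone' (a := D.src e) (b := D.tgt e)
      ⟨[e], rfl, rfl⟩) fun he => ?_
  exact List.cons_ne_nil e [] (h (D.src e) [e] ⟨rfl, he.symm⟩)

/-- Every edge increases with respect to the order on the vertices. -/
def IsIncreasing [LT V] (D : DiMultigraph V E) : Prop := ∀ e, D.src e < D.tgt e

theorem IsIncreasing.le_of_isPath [Preorder V] (h : D.IsIncreasing) {x y : V} {l : List E}
    (hl : D.IsPath x l y) : x ≤ y := by
  induction l generalizing x with
  | nil => exact hl.le
  | cons e l ih => exact hl.1 ▸ (h e).le.trans (ih hl.2)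

theorem IsIncreasing.isAcyclic [Preorder V] (h : D.IsIncreasing) : D.IsAcyclic := by
  rintro x (_ | ⟨e, l⟩) hl
  · rfl
  · exact absurd ((h e).trans_le (h.le_of_isPath hl.2)) (hl.1 ▸ lt_irrefl _)

theorem IsIncreasing.numPaths_ne_top [Preorder V] [Finite V] [Finite E] (h : D.IsIncreasing)
    (s x : V) : D.numPaths s x ≠ ⊤ := by
  classical
  have := Fintype.ofFinite E
  induction x using WellFoundedLT.induction with
  | _ x ih =>
    rw [numPaths_eq_add_sum, ← lt_top_iff_ne_top, ENat.add_lt_top, ENat.sum_lt_top]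
    refine ⟨by split_ifs <;> simp, fun e he => lt_top_iff_ne_top.2 (ih _ ?_)⟩
    simp only [Finset.mem_filter, Finset.mem_univ, true_and] at he
    exact he ▸ h e

/-- The number of directed paths from `s` to `x` as a natural number. -/
noncomputable def pathCount (D : DiMultigraph V E) (s x : V) : ℕ := (D.numPaths s x).toNat

theorem IsIncreasing.coe_pathCount [Preorder V] [Finite V] [Finite E] (h : D.IsIncreasing)
    (s x : V) : (D.pathCount s x : ℕ∞) = D.numPaths s x :=
  ENat.natCast_toNat (h.numPaths_ne_top s x)

theorem IsIncreasing.pathCount_eq [DecidableEq V] [Preorder V] [Finite V] [Fintype E]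
    (h : D.IsIncreasing) (s x : V) : D.pathCount s x =
      (if x = s then 1 else 0) + ∑ e with D.tgt e = x, D.pathCount s (D.src e) := by
  rw [← ENat.natCast_inj]
  push_cast
  simp only [h.coe_pathCount]
  exact numPaths_eq_add_sum D s x

end Paths

/-! ### Consequences of the unique source and sink. -/

section Source

variable {V : Type u} {E : Type v} {D : DiMultigraph V E} {s t : V}

theorem IsCubicDag.exists_tgt_eq (h : D.IsCubicDag s t) {x : V} (hx : x ≠ s) :
    ∃ e, D.tgt e = x := by
  by_contra! hne
  exact hx ((h.source x).1 (by simp [indeg, hne]))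

theorem IsCubicDag.exists_src_eq (h : D.IsCubicDag s t) {x : V} (hx : x ≠ t) :
    ∃ e, D.src e = x := by
  by_contra! hne
  exact hx ((h.sink x).1 (by simp [outdeg, hne]))

theorem IsCubicDag.tgt_ne_source [Finite E] (h : D.IsCubicDag s t) (e : E) : D.tgt e ≠ s := by
  intro he
  have := (h.source s).2 rfl
  rw [indeg, Set.ncard_eq_zero] at this
  exact (this ▸ he : e ∈ (∅ : Set E))

theorem IsCubicDag.src_ne_sink [Finite E] (h : D.IsCubicDag s t) (e : E) : D.src e ≠ t := by
  intro he
  have := (h.sink t).2 rfl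
  rw [outdeg, Set.ncard_eq_zero] at this
  exact (this ▸ he : e ∈ (∅ : Set E))

theorem IsCubicDag.source_le [PartialOrder V] [Finite V] (h : D.IsCubicDag s t)
    (hD : D.IsIncreasing) (x : V) : s ≤ x := by
  induction x using WellFoundedLT.induction with
  | _ x ih =>
    by_cases hx : x = s
    · exact hx.ge
    · obtain ⟨e, rfl⟩ := h.exists_tgt_eq hx
      exact (ih _ (hD e)).trans (hD e).le

theorem IsCubicDag.le_sink [PartialOrder V] [Finite V] (h : D.IsCubicDag s t)
    (hD : D.IsIncreasing) (x : V) : x ≤ t := by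
  induction x using WellFoundedGT.induction with
  | _ x ih =>
    by_cases hx : x = t
    · exact hx.le
    · obtain ⟨e, rfl⟩ := h.exists_src_eq hx
      exact (hD e).le.trans (ih _ (hD e))

theorem IsCubicDag.pathCount_pos [PartialOrder V] [Finite V] [Finite E] (h : D.IsCubicDag s t)
    (hD : D.IsIncreasing) (x : V) : 0 < D.pathCount s x := by
  classical
  have := Fintype.ofFinite E
  induction x using WellFoundedLT.induction with
  | _ x ih =>
    rw [hD.pathCount_eq]
    by_cases hx : x = s
    · simp [hx]
    · obtain ⟨e, rfl⟩ := h.exists_tgt_eq hx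
      exact Nat.add_pos_right _ (Finset.sum_pos' (fun _ _ => Nat.zero_le _)
        ⟨e, by simp, ih _ (hD e)⟩)

/-- The other edge `e'` into the same head contributes at least one further path. -/
theorem IsCubicDag.pathCount_src_lt [PartialOrder V] [Finite V] [Finite E]
    (h : D.IsCubicDag s t) (hD : D.IsIncreasing) {e e' : E} (hne : e ≠ e')
    (he : D.tgt e = D.tgt e') : D.pathCount s (D.src e) < D.pathCount s (D.tgt e) := by
  classical
  have := Fintype.ofFinite E
  rw [hD.pathCount_eq s (D.tgt e)]
  have := Finset.add_le_sum (s := Finset.univ.filter fun e'' => D.tgt e'' = D.tgt e)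
    (f := fun e => D.pathCount s (D.src e)) (fun _ _ => Nat.zero_le _) (by simp : e ∈ _)
    (by simp [he] : e' ∈ _) hne
  have := h.pathCount_pos hD (D.src e')
  omega

end Source

/-! ### The vertex order by path count, with controlled ties. -/

section Order

variable {V : Type u} {E : Type v} {D : DiMultigraph V E} {s t : V}

theorem eq_of_indeg_eq_one [Finite E] {e e' : E} (h : D.indeg (D.tgt e) = 1)
    (he : D.tgt e' = D.tgt e) : e' = e :=
  (Set.ncard_le_one_iff (Set.toFinite _)).1 h.le he rfl

/-- A root function: following unique incoming edges backwards leads to the root. -/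
theorem IsIncreasing.exists_root [PartialOrder V] [Finite V] [Finite E] (hD : D.IsIncreasing) :
    ∃ r : V → V, (∀ x, D.indeg x ≠ 1 → r x = x) ∧
      ∀ e, D.indeg (D.tgt e) = 1 → r (D.tgt e) = r (D.src e) := by
  classical
  let F : ∀ x : V, (∀ y, y < x → V) → V := fun x rec =>
    if h : ∃ e, D.tgt e = x ∧ D.indeg x = 1 then
      rec (D.src h.choose) (by have := hD h.choose; rwa [h.choose_spec.1] at this) else x
  refine ⟨(wellFounded_lt (α := V)).fix F, fun x hx => ?_, fun e he => ?_⟩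
  · rw [WellFounded.fix_eq]
    exact dif_neg fun ⟨e, he⟩ => hx he.2
  · have h : ∃ e', D.tgt e' = D.tgt e ∧ D.indeg (D.tgt e) = 1 := ⟨e, rfl, he⟩
    rw [WellFounded.fix_eq]
    refine (dif_pos h).trans ?_
    exact congrArg (fun e' => (wellFounded_lt (α := V)).fix F (D.src e'))
      (eq_of_indeg_eq_one he h.choose_spec.1)

/-- Every vertex of indegree one comes right after its predecessor or after another vertex of
indegree one. -/
def IsRootedOrder [Preorder V] (D : DiMultigraph V E) (z : V) : Prop :=
  ∀ x y, x ⋖ y → y ≤ z → D.indeg y = 1 → D.indeg x ≠ 1 → ∃ e, D.src e = x ∧ D.tgt e = y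

/-- Sort lexicographically by path count, root and an initial topological order. A vertex of
indegree one shares count and root with its predecessor, so it lies in the block headed by its root;
any other vertex is its own root. Hence the first indegree-one vertex after a root can only have
that root as predecessor. -/
theorem IsCubicDag.exists_order [Finite V] [Finite E] (h : D.IsCubicDag s t) :
    ∃ _ : LinearOrder V, D.IsIncreasing ∧ Monotone (D.pathCount s) ∧
      ∀ z, D.IsRootedOrder z := by
  obtain ⟨L, hL⟩ := h.acyclic.exists_linearOrder
  have hD : D.IsIncreasing := hL
  obtain ⟨r, hr, hr'⟩ := hD.exists_root
  have hrle : ∀ x, r x ≤ x := by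
    intro x
    induction x using WellFoundedLT.induction with
    | _ x ih =>
      by_cases hx : D.indeg x = 1
      · obtain ⟨e, rfl⟩ := h.exists_tgt_eq (x := x)
          (fun hs => by have := (h.source x).2 hs; omega)
        rw [hr' e hx]
        exact (ih _ (hD e)).trans (hD e).le
      · exact (hr x hx).le
  have hcount : ∀ e, D.indeg (D.tgt e) = 1 →
      D.pathCount s (D.tgt e) = D.pathCount s (D.src e) := by
    classical
    have := Fintype.ofFinite E
    intro e he
    rw [hD.pathCount_eq, if_neg (h.tgt_ne_source e), zero_add,
      Finset.sum_eq_single_of_mem e (by simp)]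
    intro e' he' hne
    exact absurd (eq_of_indeg_eq_one he (by simpa using he')) hne
  let key : V → ℕ ×ₗ (V ×ₗ V) := fun x => toLex (D.pathCount s x, toLex (r x, x))
  have hkey : Function.Injective key := fun x y hxy =>
    (Prod.ext_iff.1 (toLex.injective (Prod.ext_iff.1 (toLex.injective hxy)).2)).2
  have hlt : ∀ e, key (D.src e) < key (D.tgt e) := by
    intro e
    by_cases he : D.indeg (D.tgt e) = 1
    · simp [key, Prod.Lex.toLex_lt_toLex, hcount e he, hr' e he, hD e]
    · have : D.pathCount s (D.src e) < D.pathCount s (D.tgt e) := by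
        have : 1 < D.indeg (D.tgt e) := by
          have := mt (h.source (D.tgt e)).1 (h.tgt_ne_source e)
          omega
        obtain ⟨e', he', hne⟩ := Set.exists_ne_of_one_lt_ncard this e
        exact h.pathCount_src_lt hD hne.symm (Eq.symm he')
      simp [key, Prod.Lex.toLex_lt_toLex, this]
  refine ⟨LinearOrder.lift' key hkey, hlt, fun x y hxy => ?_, fun z x y hxy _ hy hx => ?_⟩
  · exact Prod.Lex.monotone_fst _ _ hxy
  · obtain ⟨e, rfl⟩ := h.exists_tgt_eq (x := y)
      (fun hs => by have := (h.source y).2 hs; omega)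
    refine ⟨e, ?_, rfl⟩
    -- The keys of `D.src e` and `D.tgt e` agree in count and root and enclose that of `x`, so `x`
    -- has the same count and root.
    have h1 : key (D.src e) ≤ key x := not_lt.1 fun hlt' => hxy.2 hlt' (hlt e)
    have h2 : key x < key (D.tgt e) := hxy.1
    simp only [key, Prod.Lex.toLex_lt_toLex, Prod.Lex.toLex_le_toLex, hcount e hy,
      hr' e hy] at h1 h2
    have hc : D.pathCount s (D.src e) = D.pathCount s x := by
      rcases h1 with h1 | h1
      · rcases h2 with h2 | h2
        · omega
        · exact h2.1.symm
      · exact h1.1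
    simp only [hc, lt_irrefl, true_and, false_or, hr x hx] at h1 h2
    have hrx : r (D.src e) = x := by
      rcases h1 with h1 | h1
      · rcases h2 with h2 | h2
        · exact absurd h1 h2.not_gt
        · exact h2.1.symm
      · exact h1.1
    refine le_antisymm ?_ (hrx ▸ hrle (D.src e))
    rcases h1 with h1 | h1
    · exact absurd h1 hrx.not_lt
    · exact h1.2

end Order

/-! ### Cuts and their crossings by a Hamiltonian tail. -/

section Cuts

variable {V : Type u} {E : Type v}

/-- The edges from outside `X` into `X`. -/
def entering (D : DiMultigraph V E) (X : Set V) : Set E := {e | D.src e ∉ X ∧ D.tgt e ∈ X}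

/-- The edges from `X` to the outside of `X`. -/
def leaving (D : DiMultigraph V E) (X : Set V) : Set E := {e | D.src e ∈ X ∧ D.tgt e ∉ X}

/-- At most one edge enters `X` and at most one edge leaves `X`. -/
def IsThin (D : DiMultigraph V E) (X : Set V) : Prop :=
  (D.entering X).Subsingleton ∧ (D.leaving X).Subsingleton

/-- No nonempty thin set avoids both `s` and `t`. -/
def NoThinSet (D : DiMultigraph V E) (s t : V) : Prop :=
  ∀ X : Set V, X.Nonempty → s ∉ X → t ∉ X → ¬ D.IsThin X

/-- The vertices from `z` on, in increasing order, form a directed path. -/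
def IsHamiltonianFrom [Preorder V] (D : DiMultigraph V E) (z : V) : Prop :=
  ∀ x y, x ⋖ y → z ≤ x → ∃ e, D.src e = x ∧ D.tgt e = y

theorem exists_covBy_crossing [LinearOrder V] [Finite V] {X : Set V} {x y : V} (hxy : x ≤ y)
    (hx : x ∈ X) (hy : y ∉ X) : ∃ p q, p ⋖ q ∧ x ≤ p ∧ q ≤ y ∧ p ∈ X ∧ q ∉ X := by
  induction y using WellFoundedLT.induction with
  | _ y ih =>
    obtain ⟨p, hp, hpy⟩ := exists_le_covBy_of_lt (hxy.lt_of_ne (by rintro rfl; exact hy hx))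
    by_cases hpX : p ∈ X
    · exact ⟨p, y, hpy, hp, le_rfl, hpX, hy⟩
    · obtain ⟨p', q', h, h1, h2, h3⟩ := ih p hpy.lt hp hpX
      exact ⟨p', q', h, h1, h2.trans hpy.le, h3⟩

variable {D : DiMultigraph V E} {s t : V}

theorem IsHamiltonianFrom.exists_leaving [LinearOrder V] [Finite V] {z x y : V} {X : Set V}
    (h : D.IsHamiltonianFrom z) (hz : z ≤ x) (hxy : x ≤ y) (hx : x ∈ X) (hy : y ∉ X) :
    ∃ e ∈ D.leaving X, x ≤ D.src e ∧ D.src e ⋖ D.tgt e ∧ D.tgt e ≤ y := by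
  obtain ⟨p, q, hpq, hxp, hqy, hp, hq⟩ := exists_covBy_crossing hxy hx hy
  obtain ⟨e, rfl, rfl⟩ := h p q hpq (hz.trans hxp)
  exact ⟨e, ⟨hp, hq⟩, hxp, hpq, hqy⟩

theorem IsHamiltonianFrom.exists_entering [LinearOrder V] [Finite V] {z x y : V} {X : Set V}
    (h : D.IsHamiltonianFrom z) (hz : z ≤ x) (hxy : x ≤ y) (hx : x ∉ X) (hy : y ∈ X) :
    ∃ e ∈ D.entering X, x ≤ D.src e ∧ D.src e ⋖ D.tgt e ∧ D.tgt e ≤ y := by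
  obtain ⟨e, he, h'⟩ := h.exists_leaving (X := Xᶜ) hz hxy hx (not_not.2 hy)
  exact ⟨e, ⟨he.1, not_not.1 he.2⟩, h'⟩

/-- Any edge into the least vertex of `X` enters `X`. -/
theorem IsCubicDag.exists_entering [LinearOrder V] [Finite V] (h : D.IsCubicDag s t)
    (hD : D.IsIncreasing) {X : Set V} (hX : X.Nonempty) (hs : s ∉ X) :
    ∃ e ∈ D.entering X, ∀ x ∈ X, D.tgt e ≤ x := by
  obtain ⟨z, hz, hmin⟩ := (wellFounded_lt (α := V)).has_min X hX
  obtain ⟨e, rfl⟩ := h.exists_tgt_eq (x := z) (by rintro rfl; exact hs hz)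
  exact ⟨e, ⟨fun he => hmin _ he (hD e), hz⟩, fun x hx => not_lt.1 (hmin x hx)⟩

theorem IsCubicDag.exists_leaving [LinearOrder V] [Finite V] (h : D.IsCubicDag s t)
    (hD : D.IsIncreasing) {X : Set V} (hX : X.Nonempty) (ht : t ∉ X) :
    ∃ e, e ∈ D.leaving X := by
  obtain ⟨z, hz, hmax⟩ := (wellFounded_gt (α := V)).has_min X hX
  obtain ⟨e, rfl⟩ := h.exists_src_eq (x := z) (by rintro rfl; exact ht hz)
  exact ⟨e, hz, fun he => hmax _ he (hD e)⟩

end Cuts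

/-! ### Permuting edge sources preserves all degrees. -/

section Perm

variable {V : Type u} {E : Type v} {D : DiMultigraph V E} {s t : V}

/-- The edges keep their targets, and their sources are permuted. -/
def permSrc (D : DiMultigraph V E) (σ : Equiv.Perm E) : DiMultigraph V E :=
  ⟨fun e => D.src (σ e), D.tgt⟩

theorem ncard_setOf_permSrc (D : DiMultigraph V E) (σ : Equiv.Perm E) (p : V → Prop) :
    {e | p ((D.permSrc σ).src e)}.ncard = {e | p (D.src e)}.ncard :=
  Set.ncard_preimage_of_injective_subset_range (s := {e | p (D.src e)}) σ.injective
    (by simp)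

theorem outdeg_permSrc (σ : Equiv.Perm E) (x : V) : (D.permSrc σ).outdeg x = D.outdeg x :=
  ncard_setOf_permSrc D σ (· = x)

theorem indeg_permSrc (σ : Equiv.Perm E) (x : V) : (D.permSrc σ).indeg x = D.indeg x := rfl

theorem IsCubicDag.permSrc [Preorder V] (h : D.IsCubicDag s t) {σ : Equiv.Perm E}
    (hσ : (D.permSrc σ).IsIncreasing) : (D.permSrc σ).IsCubicDag s t where
  threeRegular x := by rw [outdeg_permSrc, indeg_permSrc, h.threeRegular]
  acyclic := hσ.isAcyclic
  source := h.source
  sink x := by rw [outdeg_permSrc, h.sink]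

end Perm

/-! ### The exchange and its effect on path counts. -/

section Exchange

variable {V : Type u} {E : Type v}

/-- The edge `f` into `v` and the edge `g` out of the preceding vertex `u` can exchange their
sources; the vertices from `v` on form a path. -/
structure IsExchange [LinearOrder V] (D : DiMultigraph V E) (s t u v : V) (f g : E) : Prop where
  cubic : D.IsCubicDag s t
  increasing : D.IsIncreasing
  hamiltonian : D.IsHamiltonianFrom v
  covBy : u ⋖ v
  tgt_left : D.tgt f = v
  src_right : D.src g = u
  src_lt : D.src f < u
  lt_tgt : v < D.tgt g

open Classical in
/-- The graph in which the edges `f` and `g` have exchanged their sources. -/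
noncomputable def exchange (D : DiMultigraph V E) (f g : E) : DiMultigraph V E :=
  D.permSrc (Equiv.swap f g)

variable {D : DiMultigraph V E} {s t u v : V} {f g : E}

@[simp] theorem exchange_tgt (e : E) : (D.exchange f g).tgt e = D.tgt e := rfl

@[simp] theorem exchange_src_left : (D.exchange f g).src f = D.src g := by
  simp [exchange, permSrc]

@[simp] theorem exchange_src_right : (D.exchange f g).src g = D.src f := by
  simp [exchange, permSrc]

theorem exchange_src_of_ne {e : E} (hf : e ≠ f) (hg : e ≠ g) :
    (D.exchange f g).src e = D.src e := by
  classical exact congrArg D.src (Equiv.swap_apply_of_ne_of_ne hf hg)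

namespace IsExchange

variable [LinearOrder V]

theorem ne_left_of_lt (h : D.IsExchange s t u v f g) {e : E} (he : v < D.tgt e) : e ≠ f := by
  rintro rfl; exact he.ne' h.tgt_left

theorem src_of_tgt_le (h : D.IsExchange s t u v f g) {e : E} (he : D.tgt e ≤ u) :
    (D.exchange f g).src e = D.src e := by
  apply exchange_src_of_ne
  · rintro rfl; exact (h.tgt_left ▸ he).not_gt h.covBy.lt
  · rintro rfl; exact he.not_gt (h.covBy.lt.trans h.lt_tgt)

theorem src_of_le_src (h : D.IsExchange s t u v f g) {e : E} (he : v ≤ D.src e) :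
    (D.exchange f g).src e = D.src e := by
  apply exchange_src_of_ne
  · rintro rfl; exact he.not_gt (h.src_lt.trans h.covBy.lt)
  · rintro rfl; exact (h.src_right ▸ he).not_gt h.covBy.lt

theorem increasing_exchange (h : D.IsExchange s t u v f g) : (D.exchange f g).IsIncreasing := by
  intro e
  by_cases hf : e = f
  · subst hf
    rw [exchange_src_left, exchange_tgt, h.src_right, h.tgt_left]
    exact h.covBy.lt
  by_cases hg : e = g
  · subst hg
    rw [exchange_src_right, exchange_tgt]
    exact h.src_lt.trans (h.covBy.lt.trans h.lt_tgt)
  · rw [exchange_src_of_ne hf hg]; exact h.increasing e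

theorem cubic_exchange (h : D.IsExchange s t u v f g) : (D.exchange f g).IsCubicDag s t :=
  h.cubic.permSrc h.increasing_exchange

theorem hamiltonian_exchange (h : D.IsExchange s t u v f g) :
    (D.exchange f g).IsHamiltonianFrom u := by
  intro x y hxy hx
  rcases hx.eq_or_lt with rfl | hx
  · exact ⟨f, by simp [h.src_right], by simp [h.tgt_left, h.covBy.unique_right hxy]⟩
  · have hvx : v ≤ x := h.covBy.ge_of_gt hx
    obtain ⟨e, rfl, rfl⟩ := h.hamiltonian x y hxy hvx
    exact ⟨e, h.src_of_le_src hvx, rfl⟩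

/-- Both exchanged edges end after `u`, so the recursion up to `u` is unaffected. -/
theorem pathCount_eq_of_le [Finite V] [Finite E] (h : D.IsExchange s t u v f g) {x : V}
    (hx : x ≤ u) : (D.exchange f g).pathCount s x = D.pathCount s x := by
  classical
  have := Fintype.ofFinite E
  induction x using WellFoundedLT.induction with
  | _ x ih =>
    rw [h.increasing_exchange.pathCount_eq, h.increasing.pathCount_eq]
    congr 1
    refine Finset.sum_congr rfl fun e he => ?_
    obtain rfl : D.tgt e = x := by simpa using he
    rw [h.src_of_tgt_le hx]
    exact ih _ (h.increasing e) ((h.increasing e).le.trans hx)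

theorem exists_tail_edge [Finite V] (h : D.IsExchange s t u v f g) {x : V} (hx : v < x) :
    ∃ e, v ≤ D.src e ∧ D.src e ⋖ D.tgt e ∧ D.tgt e = x := by
  obtain ⟨p, hp, hpx⟩ := exists_le_covBy_of_lt hx
  obtain ⟨e, rfl, rfl⟩ := h.hamiltonian p x hpx hp
  exact ⟨e, hp, hpx, rfl⟩

/-- The induction needs the stronger claim that every vertex from `v` up to, but excluding, the head
of `g` gains δ. At that head the loss through `g` is offset by the tail edge, whose source has
gained δ. -/
theorem pathCount_add_le [Finite V] [Finite E] (h : D.IsExchange s t u v f g)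
    (hle : D.pathCount s (D.src f) ≤ D.pathCount s u) (x : V) :
    D.pathCount s x + (if v ≤ x ∧ x < D.tgt g then
      D.pathCount s u - D.pathCount s (D.src f) else 0) ≤ (D.exchange f g).pathCount s x := by
  classical
  have := Fintype.ofFinite E
  set δ := D.pathCount s u - D.pathCount s (D.src f) with hδ
  induction x using WellFoundedLT.induction with
  | _ x ih =>
    have hother : ∀ e, D.tgt e = x → e ≠ f → e ≠ g →
        D.pathCount s (D.src e) + (if v ≤ D.src e ∧ D.src e < D.tgt g then δ else 0) ≤
          (D.exchange f g).pathCount s ((D.exchange f g).src e) := by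
      rintro e rfl hf hg
      rw [exchange_src_of_ne hf hg]
      exact ih _ (h.increasing e)
    have hother' : ∀ e, D.tgt e = x → e ≠ f → e ≠ g →
        D.pathCount s (D.src e) ≤ (D.exchange f g).pathCount s ((D.exchange f g).src e) :=
      fun e he hf hg => le_of_add_le_left (hother e he hf hg)
    have hf : D.pathCount s (D.src f) + δ ≤
        (D.exchange f g).pathCount s ((D.exchange f g).src f) := by
      rw [exchange_src_left, h.src_right, h.pathCount_eq_of_le le_rfl]
      omega
    have hg : D.pathCount s (D.src g) ≤
        (D.exchange f g).pathCount s ((D.exchange f g).src g) + δ := by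
      rw [exchange_src_right, h.src_right, h.pathCount_eq_of_le h.src_lt.le]
      omega
    have hfg : g ≠ f := h.ne_left_of_lt h.lt_tgt
    have hrec : (D.exchange f g).pathCount s x = (if x = s then 1 else 0) +
        ∑ e with D.tgt e = x, (D.exchange f g).pathCount s ((D.exchange f g).src e) :=
      h.increasing_exchange.pathCount_eq s x
    rw [hrec, h.increasing.pathCount_eq s x]
    generalize (if x = s then 1 else 0) = c
    by_cases hx : v ≤ x ∧ x ≤ D.tgt g
    -- The edge `e₀` brings the gain: `f` at `v` itself, the tail edge at later vertices.
    · obtain ⟨e₀, he₀, hne, hgain⟩ : ∃ e₀, D.tgt e₀ = x ∧ e₀ ≠ g ∧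
          D.pathCount s (D.src e₀) + δ ≤
            (D.exchange f g).pathCount s ((D.exchange f g).src e₀) := by
        rcases hx.1.eq_or_lt with rfl | hvx
        · exact ⟨f, h.tgt_left, hfg.symm, hf⟩
        · obtain ⟨e, hve, -, rfl⟩ := h.exists_tail_edge hvx
          have hne : e ≠ g := by
            rintro rfl; exact (h.src_right ▸ hve).not_gt h.covBy.lt
          refine ⟨e, rfl, hne, ?_⟩
          have := hother e rfl (h.ne_left_of_lt hvx) hne
          rwa [if_pos ⟨hve, (h.increasing e).trans_le hx.2⟩] at this
      have hsum := Finset.sum_le_sum (s := Finset.univ.filter fun e => D.tgt e = x)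
        (f := fun e => D.pathCount s (D.src e) + if e = e₀ then δ else 0)
        (g := fun e => (D.exchange f g).pathCount s ((D.exchange f g).src e) +
          if e = g then δ else 0) (by
          intro e he
          have he : D.tgt e = x := by simpa using he
          by_cases h0 : e = e₀
          · subst h0; rw [if_pos rfl, if_neg hne]; exact hgain
          · rw [if_neg h0]
            by_cases hg' : e = g
            · subst hg'; rw [if_pos rfl]; exact hg
            · rw [if_neg hg']
              by_cases hf' : e = f
              · subst hf'; exact le_of_add_le_left hf
              · exact hother' e he hf' hg')
      simp only [Finset.sum_add_distrib, Finset.sum_ite_eq', Finset.mem_filter,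
        Finset.mem_univ, true_and, he₀, if_true] at hsum
      by_cases hxg : x = D.tgt g
      · rw [if_neg (fun hc => hc.2.ne hxg)]
        rw [if_pos hxg.symm] at hsum
        omega
      · rw [if_neg (Ne.symm hxg)] at hsum
        rw [if_pos ⟨hx.1, hx.2.lt_of_ne hxg⟩]
        omega
    · rw [if_neg (fun hc => hx ⟨hc.1, hc.2.le⟩), add_zero]
      refine Nat.add_le_add_left (Finset.sum_le_sum fun e he => ?_) _
      have he : D.tgt e = x := by simpa using he
      refine hother' e he ?_ ?_
      · rintro rfl; exact hx ⟨(h.tgt_left ▸ he).le, he ▸ h.tgt_left ▸ h.lt_tgt.le⟩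
      · rintro rfl; exact hx ⟨he ▸ h.lt_tgt.le, he.ge⟩

theorem pathCount_le [Finite V] [Finite E] (h : D.IsExchange s t u v f g)
    (hle : D.pathCount s (D.src f) ≤ D.pathCount s u) (x : V) :
    D.pathCount s x ≤ (D.exchange f g).pathCount s x :=
  le_of_add_le_left (h.pathCount_add_le hle x)

end IsExchange

end Exchange

/-! ### Which exchanges preserve simplicity and create no thin set. -/

section Selection

variable {V : Type u} {E : Type v} {D : DiMultigraph V E} {s t u v : V} {f g : E}

namespace IsExchange

variable [LinearOrder V]

/-- Write f : a → v and g : u → w. If `X` does not separate a from u, or v from w, the exchange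
leaves the numbers of entering and leaving edges unchanged. If it separates both pairs and also u
from v, neither edge crossed `X` before, so crossings are only added. Two configurations remain. -/
theorem crossing_of_isThin (h : D.IsExchange s t u v f g) {X : Set V} (hthin : ¬ D.IsThin X)
    (hX : (D.exchange f g).IsThin X) :
    (u ∈ X ∧ v ∈ X ∧ D.src f ∉ X ∧ D.tgt g ∉ X) ∨
      (u ∉ X ∧ v ∉ X ∧ D.src f ∈ X ∧ D.tgt g ∈ X) := by
  classical
  have hv := h.tgt_left
  have hu := h.src_right
  by_cases hau : D.src f ∈ X ↔ u ∈ X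
  · exfalso
    have hsrc : ∀ e, (D.exchange f g).src e ∈ X ↔ D.src e ∈ X := by
      intro e
      by_cases hf : e = f
      · subst hf; rw [exchange_src_left, hu, hau]
      by_cases hg : e = g
      · subst hg; rw [exchange_src_right, hu, hau]
      · rw [exchange_src_of_ne hf hg]
    apply hthin
    simpa only [IsThin, entering, leaving, hsrc, exchange_tgt] using hX
  by_cases hvw : v ∈ X ↔ D.tgt g ∈ X
  · exfalso
    have hsrc : ∀ e, (D.exchange f g).src (Equiv.swap f g e) = D.src e := by
      intro e
      by_cases hf : e = f
      · subst hf; simp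
      by_cases hg : e = g
      · subst hg; simp
      · rw [Equiv.swap_apply_of_ne_of_ne hf hg, exchange_src_of_ne hf hg]
    have htgt : ∀ e, D.tgt (Equiv.swap f g e) ∈ X ↔ D.tgt e ∈ X := by
      intro e
      by_cases hf : e = f
      · subst hf; simp [hv, hvw]
      by_cases hg : e = g
      · subst hg; simp [hv, hvw]
      · rw [Equiv.swap_apply_of_ne_of_ne hf hg]
    refine hthin ⟨fun e he e' he' => ?_, fun e he e' he' => ?_⟩
    · refine (Equiv.swap f g).injective (hX.1 ?_ ?_)
      · simpa only [entering, Set.mem_ofPred_eq, hsrc, exchange_tgt, htgt] using he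
      · simpa only [entering, Set.mem_ofPred_eq, hsrc, exchange_tgt, htgt] using he'
    · refine (Equiv.swap f g).injective (hX.2 ?_ ?_)
      · simpa only [leaving, Set.mem_ofPred_eq, hsrc, exchange_tgt, htgt] using he
      · simpa only [leaving, Set.mem_ofPred_eq, hsrc, exchange_tgt, htgt] using he'
  by_cases huv : u ∈ X ↔ v ∈ X
  · tauto
  · exfalso
    refine hthin ⟨hX.1.anti fun e he => ?_, hX.2.anti fun e he => ?_⟩
    · by_cases hf : e = f
      · subst hf; have h1 := he.1; have h2 := he.2; rw [hv] at h2; tauto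
      by_cases hg : e = g
      · subst hg; have h1 := he.1; have h2 := he.2; rw [hu] at h1; tauto
      · exact ⟨by rw [exchange_src_of_ne hf hg]; exact he.1, he.2⟩
    · by_cases hf : e = f
      · subst hf; have h1 := he.1; have h2 := he.2; rw [hv] at h2; tauto
      by_cases hg : e = g
      · subst hg; have h1 := he.1; have h2 := he.2; rw [hu] at h1; tauto
      · exact ⟨by rw [exchange_src_of_ne hf hg]; exact he.1, he.2⟩

variable [Finite V]

/-- The tail supplies a crossing beyond `u`, which by thinness is the only one in its direction. If
`v` is outside `X` and the head of `g` inside, it is a second entering edge besides one at the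
minimum of `X`, a contradiction. -/
theorem structure_of_isThin (h : D.IsExchange s t u v f g) (hD : D.NoThinSet s t) {X : Set V}
    (hs : s ∉ X) (ht : t ∉ X) (hne : X.Nonempty) (hX : (D.exchange f g).IsThin X) :
    (u ∈ X ∧ v ∈ X ∧ D.src f ∉ X ∧ D.tgt g ∉ X) ∧
      (∀ e ∈ (D.exchange f g).entering X, D.tgt e ≤ u) ∧
      ∀ e ∈ (D.exchange f g).leaving X, v ≤ (D.exchange f g).src e := by
  obtain ⟨e₀, he₀, hmin⟩ := h.cubic_exchange.exists_entering h.increasing_exchange hne hs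
  have huv := h.covBy.lt
  rcases h.crossing_of_isThin (hD X hne hs ht) hX with hc | ⟨-, hv, ha, hw⟩
  · refine ⟨hc, fun e he => hX.1 he₀ he ▸ hmin u hc.1, fun e he => ?_⟩
    obtain ⟨e₁, he₁, hle, -⟩ := h.hamiltonian_exchange.exists_leaving huv.le
      (h.cubic.le_sink h.increasing v) hc.2.1 ht
    exact hX.2 he₁ he ▸ hle
  · exfalso
    obtain ⟨e₁, he₁, hle, -⟩ := h.hamiltonian_exchange.exists_entering huv.le
      h.lt_tgt.le hv hw
    have h1 := hmin _ ha
    rw [hX.1 he₀ he₁] at h1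
    exact (hle.trans_lt (h.increasing_exchange e₁)).not_ge
      (h1.trans (h.src_lt.trans huv).le)

/-- If `u` has another outgoing edge, which does not end before `g`, no thin set arises. -/
theorem noThinSet_of_src_eq (h : D.IsExchange s t u v f g) (hD : D.NoThinSet s t) {g' : E}
    (hne : g' ≠ g) (hg' : D.src g' = u) (hle : D.tgt g ≤ D.tgt g') :
    (D.exchange f g).NoThinSet s t := by
  intro X hX hs ht hthin
  obtain ⟨⟨hu, hv, ha, hw⟩, hE, hL⟩ := h.structure_of_isThin hD hs ht hX hthin
  have hsrc : (D.exchange f g).src g' = u := by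
    rw [exchange_src_of_ne _ hne, hg']
    rintro rfl; exact h.src_lt.ne hg'
  have huv := h.covBy.lt
  -- Edges leaving `X` start at `v` or later, so `g'` stays in `X`. The tail between the heads of
  -- `g` and `g'` then enters `X` too late.
  have hw' : D.tgt g' ∈ X := by
    by_contra hw'
    exact (hsrc ▸ hL g' ⟨hsrc.symm ▸ hu, hw'⟩).not_gt huv
  obtain ⟨e, he, hle', -⟩ := h.hamiltonian_exchange.exists_entering
    (huv.trans h.lt_tgt).le hle hw hw'
  exact (((huv.trans h.lt_tgt).trans_le hle').trans (h.increasing_exchange e)).not_ge (hE e he)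

/-- The thin set is described inside `D` itself, so that bad sets of two different exchanges can be
compared. -/
theorem exists_crossing_of_not_noThinSet (h : D.IsExchange s t u v f g) (hD : D.NoThinSet s t)
    (hbad : ¬ (D.exchange f g).NoThinSet s t) :
    ∃ X : Set V, s ∉ X ∧ u ∈ X ∧ D.src f ∉ X ∧ D.tgt g ∉ X ∧
      (∀ e, D.src e ≤ u → D.src e ∈ X → e ≠ f → e ≠ g → D.tgt e ∈ X) ∧
      (∀ e, D.tgt e = v → e ≠ f → D.src e ∈ X) ∧
      ∀ e ∈ D.entering X, ∀ e' ∈ D.entering X, D.tgt e ≤ u → D.tgt e' ≤ u → e = e' := by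
  simp only [NoThinSet, not_forall, not_not] at hbad
  obtain ⟨X, hX, hs, ht, hthin⟩ := hbad
  obtain ⟨⟨hu, hv, ha, hw⟩, hE, hL⟩ := h.structure_of_isThin hD hs ht hX hthin
  refine ⟨X, hs, hu, ha, hw, fun e hle he hf hg => ?_, fun e he hf => ?_,
    fun e he e' he' hle hle' => ?_⟩
  · by_contra hne
    have hsrc := exchange_src_of_ne (D := D) hf hg
    exact (hL e ⟨hsrc ▸ he, hne⟩).not_gt (hsrc ▸ hle.trans_lt h.covBy.lt)
  · by_contra hne
    have hsrc := exchange_src_of_ne (D := D) (g := g) hf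
      (by rintro rfl; exact h.lt_tgt.ne' he)
    exact (he ▸ hE e ⟨hsrc ▸ hne, he ▸ hv⟩).not_gt h.covBy.lt
  · exact hthin.1 ⟨h.src_of_tgt_le hle ▸ he.1, he.2⟩ ⟨h.src_of_tgt_le hle' ▸ he'.1, he'.2⟩

/-- If both exchanges fail, the bad sets `X₁`, `X₂` share `u`, and the source of `f₁` lies only in
`X₂`, that of `f₂` only in `X₁`. An edge entering the intersection enters one of the sets with its
head in the other, which forces the first set into the second up to `u`, a contradiction. -/
theorem noThinSet_or_noThinSet {f₁ f₂ : E} (h₁ : D.IsExchange s t u v f₁ g)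
    (h₂ : D.IsExchange s t u v f₂ g) (hne : f₁ ≠ f₂) (hD : D.NoThinSet s t) :
    (D.exchange f₁ g).NoThinSet s t ∨ (D.exchange f₂ g).NoThinSet s t := by
  by_contra! hbad
  obtain ⟨X₁, hs₁, hu₁, ha₁, -, hL₁, hb₁, hE₁⟩ :=
    h₁.exists_crossing_of_not_noThinSet hD hbad.1
  obtain ⟨X₂, hs₂, hu₂, ha₂, -, hL₂, hb₂, hE₂⟩ :=
    h₂.exists_crossing_of_not_noThinSet hD hbad.2
  have hcubic := h₁.cubic
  have hinc := h₁.increasing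
  have hneq : ∀ e f, D.IsExchange s t u v f g → D.tgt e ≤ u → e ≠ f ∧ e ≠ g := by
    refine fun e f h he => ⟨?_, ?_⟩
    · rintro rfl; exact (h.tgt_left ▸ he).not_gt h.covBy.lt
    · rintro rfl; exact he.not_gt (h.covBy.lt.trans h.lt_tgt)
  -- Walking backwards inside `X` ends at its only entering edge `e₀`, whose head is in `Y`; up to
  -- `u`, no edge leads out of `Y`.
  have key : ∀ (X Y : Set V), s ∉ X →
      (∀ e ∈ D.entering X, ∀ e' ∈ D.entering X, D.tgt e ≤ u → D.tgt e' ≤ u → e = e') →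
      (∀ e, D.tgt e ≤ u → D.src e ∈ Y → D.tgt e ∈ Y) →
      ∀ e₀ ∈ D.entering X, D.tgt e₀ ≤ u → D.tgt e₀ ∈ Y → ∀ x, x ≤ u → x ∈ X → x ∈ Y := by
    intro X Y hs hE hL e₀ he₀ hle₀ hY x
    induction x using WellFoundedLT.induction with
    | _ x ih =>
      intro hx hxX
      obtain ⟨e, rfl⟩ := hcubic.exists_tgt_eq (x := x) (by rintro rfl; exact hs hxX)
      by_cases hsrc : D.src e ∈ X
      · exact hL e hx (ih _ (hinc e) ((hinc e).le.trans hx) hsrc)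
      · rw [← hE e₀ he₀ e ⟨hsrc, hxX⟩ hle₀ hx]; exact hY
  obtain ⟨e, he, hmin⟩ := hcubic.exists_entering hinc (X := X₁ ∩ X₂) ⟨u, hu₁, hu₂⟩
    (fun h => hs₁ h.1)
  have hle := hmin u ⟨hu₁, hu₂⟩
  have hclosed : ∀ (X : Set V) (f : E), D.IsExchange s t u v f g →
      (∀ e, D.src e ≤ u → D.src e ∈ X → e ≠ f → e ≠ g → D.tgt e ∈ X) →
      ∀ e, D.tgt e ≤ u → D.src e ∈ X → D.tgt e ∈ X := fun X f h hL e hle he =>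
    hL e ((hinc e).le.trans hle) he (hneq e f h hle).1 (hneq e f h hle).2
  by_cases hsrc : D.src e ∈ X₁
  · exact ha₁ (key X₂ X₁ hs₂ hE₂ (hclosed X₁ f₁ h₁ hL₁) e ⟨fun h => he.1 ⟨hsrc, h⟩, he.2.2⟩
      hle he.2.1 _ h₁.src_lt.le (hb₂ f₁ h₁.tgt_left hne))
  · exact ha₂ (key X₁ X₂ hs₁ hE₁ (hclosed X₂ f₂ h₂ hL₂) e ⟨hsrc, he.2.1⟩
      hle he.2.2 _ h₂.src_lt.le (hb₁ f₂ h₂.tgt_left hne.symm))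

/-- The edge `k` is what makes `f₁` unusable for simplicity. A bad set for `f₂` would contain the
source of `f₁` but not the head of `g`, so `k` would leave it too early. -/
theorem noThinSet_of_edge {f₁ f₂ : E} (h₁ : D.IsExchange s t u v f₁ g)
    (h₂ : D.IsExchange s t u v f₂ g) (hne : f₁ ≠ f₂) (hD : D.NoThinSet s t) {k : E}
    (hk : D.src k = D.src f₁) (hk' : D.tgt k = D.tgt g) :
    (D.exchange f₂ g).NoThinSet s t := by
  by_contra hbad
  obtain ⟨X, -, -, -, hw, hL, hb, -⟩ := h₂.exists_crossing_of_not_noThinSet hD hbad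
  refine hw (hk' ▸ hL k (hk ▸ h₁.src_lt.le) (hk ▸ hb f₁ h₁.tgt_left hne) ?_ ?_)
  · exact h₂.ne_left_of_lt (hk'.symm ▸ h₂.lt_tgt)
  · rintro rfl; exact h₁.src_lt.ne (hk.symm.trans h₁.src_right)

end IsExchange

theorem IsIncreasing.isSimple_iff [Preorder V] (hD : D.IsIncreasing) :
    D.IsSimple ↔ ∀ e e', D.src e = D.src e' → D.tgt e = D.tgt e' → e = e' := by
  refine ⟨fun h e e' h1 h2 => h.2 (by simp [h1, h2]), fun h => ⟨fun e => (hD e).ne, ?_⟩⟩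
  intro e e' he
  rcases Sym2.eq_iff.1 he with ⟨h1, h2⟩ | ⟨h1, h2⟩
  · exact h e e' h1 h2
  · have h3 := hD e
    rw [h1, h2] at h3
    exact absurd h3 (hD e').not_gt

namespace IsExchange

variable [LinearOrder V]

theorem isSimple_exchange (h : D.IsExchange s t u v f g) (hD : D.IsSimple)
    (huv : ¬ ∃ e, D.src e = u ∧ D.tgt e = v)
    (haw : ¬ ∃ e, D.src e = D.src f ∧ D.tgt e = D.tgt g) : (D.exchange f g).IsSimple := by
  rw [h.increasing.isSimple_iff] at hD
  rw [h.increasing_exchange.isSimple_iff]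
  have key : ∀ e e', (D.exchange f g).src e = (D.exchange f g).src e' → D.tgt e = D.tgt e' →
      e ≠ f → e ≠ g → e = e' := by
    intro e e' h1 h2 hf hg
    rw [exchange_src_of_ne hf hg] at h1
    by_cases hf' : e' = f
    · subst hf'
      rw [exchange_src_left] at h1
      exact absurd ⟨e, h1.trans h.src_right, h2.trans h.tgt_left⟩ huv
    by_cases hg' : e' = g
    · subst hg'
      rw [exchange_src_right] at h1
      exact absurd ⟨e, h1, h2⟩ haw
    · rw [exchange_src_of_ne hf' hg'] at h1
      exact hD e e' h1 h2
  have hvw : D.tgt f ≠ D.tgt g := h.tgt_left ▸ h.lt_tgt.ne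
  intro e e' h1 h2
  have h2 : D.tgt e = D.tgt e' := h2
  by_cases he : e ≠ f ∧ e ≠ g
  · exact key e e' h1 h2 he.1 he.2
  by_cases he' : e' ≠ f ∧ e' ≠ g
  · exact (key e' e h1.symm h2.symm he'.1 he'.2).symm
  · have h3 : e = f ∨ e = g := by tauto
    have h4 : e' = f ∨ e' = g := by tauto
    rcases h3 with rfl | rfl <;> rcases h4 with rfl | rfl
    · rfl
    · exact absurd h2 hvw
    · exact absurd h2.symm hvw
    · rfl

theorem exists_tail_edge_tgt [Finite V] (h : D.IsExchange s t u v f g) :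
    ∃ e, v ≤ D.src e ∧ D.tgt e = D.tgt g := by
  obtain ⟨e, he, -, he'⟩ := h.exists_tail_edge h.lt_tgt
  exact ⟨e, he, he'⟩

end IsExchange

theorem IsThreeRegular.indeg_le (h : D.IsThreeRegular) (x : V) : D.indeg x ≤ 3 := by
  have := h x
  omega

theorem card_le_indeg [Finite E] [DecidableEq E] {S : Finset E} {x : V}
    (hS : ∀ e ∈ S, D.tgt e = x) : S.card ≤ D.indeg x := by
  rw [← Set.ncard_coe_finset]
  exact Set.ncard_le_ncard hS

namespace IsExchange

variable [LinearOrder V] [Finite V] [Finite E]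

/-- The edges `k`, `g` and the tail edge already use up the degree of the head of `g`. -/
theorem tgt_eq_sink_of_edge (h : D.IsExchange s t u v f g) {k : E} (hk : D.src k = D.src f)
    (hk' : D.tgt k = D.tgt g) : D.tgt g = t := by
  classical
  obtain ⟨e, he, he'⟩ := h.exists_tail_edge_tgt
  have huv := h.covBy.lt
  have h1 : k ≠ g := by rintro rfl; exact h.src_lt.ne (hk.symm.trans h.src_right)
  have h2 : k ≠ e := by
    rintro rfl; exact (hk ▸ he).not_gt (h.src_lt.trans huv)
  have h3 : g ≠ e := by
    rintro rfl; exact (h.src_right ▸ he).not_gt huv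
  have hcard : ({k, g, e} : Finset E).card = 3 := Finset.card_eq_three.2
    ⟨k, g, e, h1, h2, h3, rfl⟩
  have := card_le_indeg (D := D) (S := {k, g, e}) (x := D.tgt g) (by simp [hk', he'])
  have h3 := h.cubic.threeRegular (D.tgt g)
  exact (h.cubic.sink _).1 (by omega)

/-- Together with `g` and the tail edge there would be four edges into one vertex. -/
theorem not_edge_and_edge {f₁ f₂ : E} (h₁ : D.IsExchange s t u v f₁ g)
    (h₂ : D.IsExchange s t u v f₂ g) (hne : D.src f₁ ≠ D.src f₂) {k₁ k₂ : E}
    (hk₁ : D.src k₁ = D.src f₁) (hk₁' : D.tgt k₁ = D.tgt g)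
    (hk₂ : D.src k₂ = D.src f₂) (hk₂' : D.tgt k₂ = D.tgt g) : False := by
  classical
  obtain ⟨e, he, he'⟩ := h₁.exists_tail_edge_tgt
  have huv := h₁.covBy.lt
  have h12 : k₁ ≠ k₂ := by rintro rfl; exact hne (hk₁.symm.trans hk₂)
  have h1g : k₁ ≠ g := by rintro rfl; exact h₁.src_lt.ne (hk₁.symm.trans h₁.src_right)
  have h2g : k₂ ≠ g := by rintro rfl; exact h₂.src_lt.ne (hk₂.symm.trans h₂.src_right)
  have h1e : k₁ ≠ e := by
    rintro rfl; exact (hk₁ ▸ he).not_gt (h₁.src_lt.trans huv)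
  have h2e : k₂ ≠ e := by
    rintro rfl; exact (hk₂ ▸ he).not_gt (h₂.src_lt.trans huv)
  have hge : g ≠ e := by
    rintro rfl; exact (h₁.src_right ▸ he).not_gt huv
  have hcard : ({k₁, k₂, g, e} : Finset E).card = 4 := by
    rw [Finset.card_insert_of_notMem (by simp [h12, h1g, h1e]),
      Finset.card_eq_three.2 ⟨k₂, g, e, h2g, h2e, hge, rfl⟩]
  have := card_le_indeg (D := D) (S := {k₁, k₂, g, e}) (x := D.tgt g)
    (by simp [hk₁', hk₂', he'])
  have := h₁.cubic.threeRegular.indeg_le (D.tgt g)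
  omega

end IsExchange

end Selection

/-! ### One repair step and the downward induction. -/

section Step

variable {V : Type u} {E : Type v} [LinearOrder V]

/-- The invariant of the exchange procedure that has arrived at the vertex `z`. -/
structure IsHamiltonianAbove (D : DiMultigraph V E) (s t z : V) : Prop where
  cubic : D.IsCubicDag s t
  increasing : D.IsIncreasing
  hamiltonian : D.IsHamiltonianFrom z
  monotone : ∀ x y, x ≤ y → y ≤ z → D.pathCount s x ≤ D.pathCount s y
  rooted : D.IsRootedOrder z

variable [Finite V] [Finite E] {D : DiMultigraph V E} {s t u v : V}

theorem IsHamiltonianAbove.exists_exchange (h : D.IsHamiltonianAbove s t v) (huv : u ⋖ v)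
    (hedge : ¬ ∃ e, D.src e = u ∧ D.tgt e = v) :
    ∃ f g, D.IsExchange s t u v f g ∧ (D.IsSimple → (D.exchange f g).IsSimple) ∧
      (D.NoThinSet s t → (D.exchange f g).NoThinSet s t) := by
  have hsu := h.cubic.source_le h.increasing u
  have hvt := h.cubic.le_sink h.increasing v
  have hut : u ≠ t := (huv.lt.trans_le hvt).ne
  have hvs : v ≠ s := (hsu.trans_lt huv.lt).ne'
  obtain ⟨g, hg, hgmin⟩ : ∃ g, D.src g = u ∧ ∀ g', D.src g' = u → D.tgt g ≤ D.tgt g' :=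
    Set.exists_min_image {e | D.src e = u} D.tgt (Set.toFinite _) (h.cubic.exists_src_eq hut)
  have hex : ∀ f, D.tgt f = v → D.IsExchange s t u v f g := fun f hf =>
    { cubic := h.cubic
      increasing := h.increasing
      hamiltonian := h.hamiltonian
      covBy := huv
      tgt_left := hf
      src_right := hg
      src_lt := lt_of_le_of_ne (huv.le_of_lt (hf ▸ h.increasing f)) fun he =>
        hedge ⟨f, he, hf⟩
      lt_tgt := lt_of_le_of_ne (huv.ge_of_gt (hg ▸ h.increasing g)) fun he =>
        hedge ⟨g, hg, he.symm⟩ }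
  by_cases htwo : ∃ g', g' ≠ g ∧ D.src g' = u
  · obtain ⟨g', hne, hg'⟩ := htwo
    obtain ⟨f, hf⟩ := h.cubic.exists_tgt_eq hvs
    refine ⟨f, g, hex f hf, fun hD => ?_, fun hD => ?_⟩
    · refine (hex f hf).isSimple_exchange hD hedge ?_
      rintro ⟨k, hk, hk'⟩
      -- Minimality of the head of `g` now sends `g'` to the sink as well, making it parallel to
      -- `g`.
      have ht := (hex f hf).tgt_eq_sink_of_edge hk hk'
      have ht' : D.tgt g' = t :=
        le_antisymm (h.cubic.le_sink h.increasing _) (ht ▸ hgmin g' hg')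
      exact hne ((h.increasing.isSimple_iff.1 hD) g' g (hg'.trans hg.symm)
        (ht'.trans ht.symm))
    · exact (hex f hf).noThinSet_of_src_eq hD hne hg' (hgmin g' hg')
  · have hout : D.outdeg u = 1 := by
      rw [outdeg, Set.ncard_eq_one]
      refine ⟨g, Set.eq_singleton_iff_unique_mem.2 ⟨hg, fun g' hg' => ?_⟩⟩
      by_contra hne
      exact htwo ⟨g', hne, hg'⟩
    -- Hence `v` cannot have indegree one: the rooted order would provide the missing edge from `u`.
    have hin : D.indeg u ≠ 1 := by have := h.cubic.threeRegular u; omega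
    have hinv : 1 < D.indeg v := by
      have h0 : D.indeg v ≠ 0 := mt (h.cubic.source v).1 hvs
      have h1 : D.indeg v ≠ 1 := fun h1 => hedge (h.rooted u v huv le_rfl h1 hin)
      omega
    obtain ⟨f₁, f₂, hf₁, hf₂, hne⟩ := (Set.one_lt_ncard_iff (Set.toFinite _)).1 hinv
    have h₁ := hex f₁ hf₁
    have h₂ := hex f₂ hf₂
    have hsimple : D.IsSimple → D.src f₁ ≠ D.src f₂ := fun hD he =>
      hne (h.increasing.isSimple_iff.1 hD f₁ f₂ he (hf₁.trans hf₂.symm))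
    by_cases hk₁ : D.IsSimple ∧ ∃ k, D.src k = D.src f₁ ∧ D.tgt k = D.tgt g
    · obtain ⟨hD, k, hk, hk'⟩ := hk₁
      exact ⟨f₂, g, h₂, fun _ => h₂.isSimple_exchange hD hedge fun ⟨k', hk'', hk'''⟩ =>
        h₁.not_edge_and_edge h₂ (hsimple hD) hk hk' hk'' hk''',
        fun hT => h₁.noThinSet_of_edge h₂ hne hT hk hk'⟩
    by_cases hk₂ : D.IsSimple ∧ ∃ k, D.src k = D.src f₂ ∧ D.tgt k = D.tgt g
    · obtain ⟨hD, k, hk, hk'⟩ := hk₂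
      exact ⟨f₁, g, h₁, fun _ => h₁.isSimple_exchange hD hedge fun ⟨k', hk'', hk'''⟩ =>
        h₁.not_edge_and_edge h₂ (hsimple hD) hk'' hk''' hk hk',
        fun hT => h₂.noThinSet_of_edge h₁ hne.symm hT hk hk'⟩
    have hs₁ : D.IsSimple → (D.exchange f₁ g).IsSimple := fun hD =>
      h₁.isSimple_exchange hD hedge fun hk => hk₁ ⟨hD, hk⟩
    have hs₂ : D.IsSimple → (D.exchange f₂ g).IsSimple := fun hD =>
      h₂.isSimple_exchange hD hedge fun hk => hk₂ ⟨hD, hk⟩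
    -- Neither choice endangers simplicity here, so thin sets alone decide.
    by_cases hT : D.NoThinSet s t
    · rcases h₁.noThinSet_or_noThinSet h₂ hne hT with hT' | hT'
      · exact ⟨f₁, g, h₁, hs₁, fun _ => hT'⟩
      · exact ⟨f₂, g, h₂, hs₂, fun _ => hT'⟩
    · exact ⟨f₁, g, h₁, hs₁, fun hT' => absurd hT' hT⟩

theorem IsHamiltonianAbove.exchange (h : D.IsHamiltonianAbove s t v) {f g : E}
    (hex : D.IsExchange s t u v f g) : (D.exchange f g).IsHamiltonianAbove s t u where
  cubic := hex.cubic_exchange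
  increasing := hex.increasing_exchange
  hamiltonian := hex.hamiltonian_exchange
  monotone x y hxy hy := by
    rw [hex.pathCount_eq_of_le hy, hex.pathCount_eq_of_le (hxy.trans hy)]
    exact h.monotone x y hxy (hy.trans hex.covBy.le)
  rooted x y hxy hy hin hout := by
    rw [DiMultigraph.exchange, indeg_permSrc] at hin hout
    obtain ⟨e, rfl, rfl⟩ := h.rooted x y hxy (hy.trans hex.covBy.le) hin hout
    exact ⟨e, hex.src_of_tgt_le hy, rfl⟩

theorem IsHamiltonianAbove.exists_permSrc (h : D.IsHamiltonianAbove s t v) (huv : u ⋖ v) :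
    ∃ σ, (D.permSrc σ).IsHamiltonianAbove s t u ∧
      (∀ x, D.pathCount s x ≤ (D.permSrc σ).pathCount s x) ∧
      (D.IsSimple → (D.permSrc σ).IsSimple) ∧
      (D.NoThinSet s t → (D.permSrc σ).NoThinSet s t) := by
  by_cases hedge : ∃ e, D.src e = u ∧ D.tgt e = v
  · refine ⟨1, ⟨h.cubic, h.increasing, fun x y hxy hx => ?_, fun x y hxy hy =>
      h.monotone x y hxy (hy.trans huv.le), fun x y hxy hy => h.rooted x y hxy
      (hy.trans huv.le)⟩, fun x => le_rfl, id, id⟩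
    rcases hx.eq_or_lt with rfl | hx
    · rw [hxy.unique_right huv]; exact hedge
    · exact h.hamiltonian x y hxy (huv.ge_of_gt hx)
  · obtain ⟨f, g, hex, hs, hT⟩ := h.exists_exchange huv hedge
    exact ⟨_, h.exchange hex, hex.pathCount_le
      (h.monotone _ _ hex.src_lt.le huv.le), hs, hT⟩

theorem IsCubicDag.exists_hamiltonian (h : D.IsCubicDag s t) (hD : D.IsIncreasing)
    (hmono : Monotone (D.pathCount s)) (hroot : ∀ z, D.IsRootedOrder z) :
    ∃ σ, (D.permSrc σ).IsCubicDag s t ∧ (D.permSrc σ).IsIncreasing ∧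
      (D.permSrc σ).IsHamiltonianFrom s ∧
      (∀ x, D.pathCount s x ≤ (D.permSrc σ).pathCount s x) ∧
      (D.IsSimple → (D.permSrc σ).IsSimple) ∧
      (D.NoThinSet s t → (D.permSrc σ).NoThinSet s t) := by
  have key : ∀ z, ∃ σ, (D.permSrc σ).IsHamiltonianAbove s t z ∧
      (∀ x, D.pathCount s x ≤ (D.permSrc σ).pathCount s x) ∧
      (D.IsSimple → (D.permSrc σ).IsSimple) ∧
      (D.NoThinSet s t → (D.permSrc σ).NoThinSet s t) := by
    intro z
    induction z using WellFoundedGT.induction with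
    | _ z ih =>
      rcases (h.le_sink hD z).eq_or_lt with rfl | hz
      · exact ⟨1, ⟨h, hD, fun x y hxy hx => absurd (hx.trans_lt hxy.lt)
          (h.le_sink hD y).not_gt, fun x y hxy _ => hmono hxy, hroot _⟩,
          fun x => le_rfl, id, id⟩
      · obtain ⟨z', hzz', -⟩ := exists_covBy_le_of_lt hz
        obtain ⟨σ, h1, h2, h3, h4⟩ := ih z' hzz'.lt
        obtain ⟨τ, h1', h2', h3', h4'⟩ := h1.exists_permSrc hzz'
        exact ⟨σ * τ, h1', fun x => (h2 x).trans (h2' x), h3' ∘ h3, h4' ∘ h4⟩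
  obtain ⟨σ, h1, h2⟩ := key s
  exact ⟨σ, h1.cubic, h1.increasing, h1.hamiltonian, h2⟩

end Step

/-! ### Edge connectivity through cuts. -/

section Connectivity

variable {V : Type u} {E : Type v} {D : DiMultigraph V E} {s t : V} {k : ℕ}

/-- The edges between `X` and its complement. -/
def cut (D : DiMultigraph V E) (X : Set V) : Set E := D.leaving X ∪ D.entering X

theorem leaving_compl (D : DiMultigraph V E) (X : Set V) : D.leaving Xᶜ = D.entering X := by
  ext e; simp [leaving, entering]

theorem entering_compl (D : DiMultigraph V E) (X : Set V) : D.entering Xᶜ = D.leaving X := by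
  ext e; simp [leaving, entering]

theorem cut_compl (D : DiMultigraph V E) (X : Set V) : D.cut Xᶜ = D.cut X := by
  rw [cut, leaving_compl, entering_compl, Set.union_comm, cut]

theorem disjoint_leaving_entering (D : DiMultigraph V E) (X : Set V) :
    Disjoint (D.leaving X) (D.entering X) :=
  Set.disjoint_left.2 fun _ h h' => h'.1 h.1

theorem edgeConnected_iff [Nonempty V] [Finite E] :
    D.EdgeConnected k ↔ ∀ X : Set V, X.Nonempty → Xᶜ.Nonempty → k ≤ (D.cut X).ncard := by
  constructor
  · rintro h X ⟨x, hx⟩ ⟨y, hy⟩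
    by_contra! hlt
    have hfin := Set.toFinite (D.cut X)
    rw [Set.ncard_eq_toFinset_card _ hfin] at hlt
    obtain ⟨p⟩ := (h _ hlt).preconnected x y
    apply hy
    clear hy
    induction p with
    | nil => exact hx
    | cons hadj p ih =>
      apply ih
      obtain ⟨-, ⟨e, he, rfl, rfl⟩ | ⟨e, he, rfl, rfl⟩⟩ := (SimpleGraph.fromRel_adj _ _ _).1 hadj
      · by_contra hne
        exact he (hfin.mem_toFinset.2 (Or.inl ⟨hx, hne⟩))
      · by_contra hne
        exact he (hfin.mem_toFinset.2 (Or.inr ⟨hne, hx⟩))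
  · intro h F hF
    refine (SimpleGraph.connected_iff _).2 ⟨fun x y => ?_, inferInstance⟩
    by_contra hxy
    have hcut := h {z | (D.underlyingDelete F).Reachable x z} ⟨x, SimpleGraph.Reachable.refl x⟩
      ⟨y, hxy⟩
    have hadj : ∀ e ∉ F, D.src e ≠ D.tgt e → (D.underlyingDelete F).Adj (D.src e) (D.tgt e) :=
      fun e he hne => (SimpleGraph.fromRel_adj _ _ _).2 ⟨hne, Or.inl ⟨e, he, rfl, rfl⟩⟩
    have hsub : D.cut {z | (D.underlyingDelete F).Reachable x z} ⊆ F := by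
      rintro e (⟨h1, h2⟩ | ⟨h1, h2⟩)
      · by_contra he
        exact h2 (SimpleGraph.Reachable.trans h1
          (hadj e he fun heq => h2 (heq ▸ h1)).reachable)
      · by_contra he
        exact h1 (SimpleGraph.Reachable.trans h2
          (hadj e he fun heq => h1 (heq ▸ h2)).symm.reachable)
    have := Set.ncard_le_ncard hsub
    rw [Set.ncard_coe_finset] at this
    omega

theorem EdgeConnected.noThinSet [Finite E] (h : D.EdgeConnected 3) : D.NoThinSet s t := by
  intro X hX hs _ hthin
  have : Nonempty V := ⟨s⟩
  have h3 := edgeConnected_iff.1 h X hX ⟨s, hs⟩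
  have h1 := Set.ncard_union_le (D.leaving X) (D.entering X)
  have h2 := Set.ncard_le_one_iff_subsingleton.2 hthin.1
  have h2' := Set.ncard_le_one_iff_subsingleton.2 hthin.2
  rw [cut] at h3
  omega

variable [LinearOrder V]

theorem IsIncreasing.entering_Iic (hD : D.IsIncreasing) (p : V) :
    D.entering (Set.Iic p) = ∅ :=
  Set.eq_empty_of_forall_notMem fun e he => he.1 ((hD e).le.trans he.2)

/-- No edge enters a prefix, so its cut size is the number of sources in it minus the number of
targets in it, and both are invariant. -/
theorem ncard_leaving_Iic_permSrc [Finite E] (hD : D.IsIncreasing) {σ : Equiv.Perm E}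
    (hσ : (D.permSrc σ).IsIncreasing) (p : V) :
    ((D.permSrc σ).leaving (Set.Iic p)).ncard = (D.leaving (Set.Iic p)).ncard := by
  have key : ∀ D' : DiMultigraph V E, D'.IsIncreasing → (D'.leaving (Set.Iic p)).ncard =
      {e | D'.src e ≤ p}.ncard - {e | D'.tgt e ≤ p}.ncard := fun D' hD' => by
    have hsub : {e | D'.tgt e ≤ p} ⊆ {e | D'.src e ≤ p} :=
      fun e (he : D'.tgt e ≤ p) => (hD' e).le.trans he
    rw [← Set.ncard_sdiff hsub]
    rfl
  rw [key _ hσ, key _ hD, ncard_setOf_permSrc D σ (· ≤ p)]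
  rfl

/-- If `t ∈ X`, the complement has an edge in and an edge out, and a third unless it is thin. If `t
∉ X`, either `X` is a prefix or the Hamiltonian path leaves, re-enters and leaves it again. -/
theorem IsCubicDag.le_ncard_cut [Finite V] [Finite E] (h : D.IsCubicDag s t)
    (hD : D.IsIncreasing) (hham : D.IsHamiltonianFrom s) (hk : k ≤ 3)
    (hthin : k = 3 → D.NoThinSet s t)
    (hprefix : ∀ p, p ≠ t → k ≤ (D.leaving (Set.Iic p)).ncard) {X : Set V}
    (hs : s ∈ X) (hX : Xᶜ.Nonempty) : k ≤ (D.cut X).ncard := by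
  classical
  by_cases ht : t ∈ X
  · obtain ⟨e, he, -⟩ := h.exists_entering hD hX (not_not.2 hs)
    obtain ⟨e', he'⟩ := h.exists_leaving hD hX (not_not.2 ht)
    have h1 := (Set.ncard_pos (Set.toFinite _)).2 ⟨e, he⟩
    have h2 := (Set.ncard_pos (Set.toFinite _)).2 ⟨e', he'⟩
    rw [← cut_compl, cut, Set.ncard_union_eq (D.disjoint_leaving_entering _)]
    by_contra! hlt
    refine hthin (by omega) Xᶜ hX (not_not.2 hs) (not_not.2 ht)
      ⟨Set.ncard_le_one_iff_subsingleton.1 ?_, Set.ncard_le_one_iff_subsingleton.1 ?_⟩ <;> omega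
  by_cases hlow : ∀ x ∈ X, ∀ y ≤ x, y ∈ X
  · obtain ⟨e, he, -, hcov, -⟩ := hham.exists_leaving le_rfl (h.source_le hD t) hs ht
    have hXp : X = Set.Iic (D.src e) := by
      ext x
      refine ⟨fun hx => ?_, fun hx => hlow _ he.1 x hx⟩
      exact hcov.le_of_lt (not_le.1 fun hle => he.2 (hlow x hx _ hle))
    rw [hXp]
    exact (hprefix _ (h.src_ne_sink e)).trans (Set.ncard_le_ncard Set.subset_union_left)
  · push Not at hlow
    obtain ⟨x, hx, y, hyx, hy⟩ := hlow
    obtain ⟨e₁, he₁, -, -, h₁⟩ := hham.exists_leaving le_rfl (h.source_le hD y) hs hy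
    obtain ⟨e₂, he₂, h₂, -, h₂'⟩ := hham.exists_entering (h.source_le hD y) hyx hy hx
    obtain ⟨e₃, he₃, h₃, -, -⟩ :=
      hham.exists_leaving (h.source_le hD x) (h.le_sink hD x) hx ht
    have h12 : D.src e₁ < D.src e₂ := (hD e₁).trans_le (h₁.trans h₂)
    have h23 : D.src e₂ < D.src e₃ := (hD e₂).trans_le (h₂'.trans h₃)
    have hcard : ({e₁, e₂, e₃} : Finset E).card = 3 := Finset.card_eq_three.2
      ⟨e₁, e₂, e₃, fun he => h12.ne (he ▸ rfl), fun he => (h12.trans h23).ne (he ▸ rfl),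
        fun he => h23.ne (he ▸ rfl), rfl⟩
    have hsub : (({e₁, e₂, e₃} : Finset E) : Set E) ⊆ D.cut X := by
      intro e he
      simp only [Finset.coe_insert, Finset.coe_singleton, Set.mem_insert_iff,
        Set.mem_singleton_iff] at he
      rcases he with rfl | rfl | rfl
      exacts [Or.inl he₁, Or.inr he₂, Or.inl he₃]
    have := Set.ncard_le_ncard hsub
    rw [Set.ncard_coe_finset, hcard] at this
    omega

theorem EdgeConnected.permSrc [Finite V] [Finite E] (hconn : D.EdgeConnected k) (hk : k ≤ 3)
    (hD : D.IsIncreasing) (h : D.IsCubicDag s t) {σ : Equiv.Perm E}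
    (hσ : (D.permSrc σ).IsIncreasing) (hham : (D.permSrc σ).IsHamiltonianFrom s)
    (hthin : D.NoThinSet s t → (D.permSrc σ).NoThinSet s t) :
    (D.permSrc σ).EdgeConnected k := by
  have : Nonempty V := ⟨s⟩
  have h' := h.permSrc hσ
  have hprefix : ∀ p, p ≠ t → k ≤ ((D.permSrc σ).leaving (Set.Iic p)).ncard := by
    intro p hp
    rw [ncard_leaving_Iic_permSrc hD hσ]
    have := edgeConnected_iff.1 hconn (Set.Iic p) ⟨p, le_rfl⟩
      ⟨t, fun ht => hp (le_antisymm (h.le_sink hD p) ht)⟩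
    rwa [cut, hD.entering_Iic, Set.union_empty] at this
  have key : ∀ X : Set V, s ∈ X → Xᶜ.Nonempty → k ≤ ((D.permSrc σ).cut X).ncard :=
    fun X hs hX => h'.le_ncard_cut hσ hham hk
      (fun hk3 => hthin (EdgeConnected.noThinSet (hk3 ▸ hconn))) hprefix hs hX
  refine edgeConnected_iff.2 fun X hX hX' => ?_
  by_cases hs : s ∈ X
  · exact key X hs hX'
  · rw [← cut_compl]
    exact key Xᶜ hs (by rwa [compl_compl])

end Connectivity

/-! ### The improvement theorem and the edge count. -/

section Main

variable {V : Type u} {E : Type v} {s t : V}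

theorem IsCubicDag.exists_hamiltonian_improvement [Fintype V] [Finite E]
    {D : DiMultigraph V E} (h : D.IsCubicDag s t) :
    ∃ (y : Fin (Fintype.card V) ≃ V) (D' : DiMultigraph V E),
      D.IsTopologicalOrder y ∧ Monotone (fun i => D.numPaths s (y i)) ∧ D'.IsCubicDag s t ∧
      D'.IsTopologicalOrder y ∧ D'.IsHamiltonianPath y ∧
      (∀ x, D.numPaths s x ≤ D'.numPaths s x) ∧ (D.IsSimple → D'.IsSimple) ∧
      ∀ k ≤ 3, D.EdgeConnected k → D'.EdgeConnected k := by
  obtain ⟨L, hD, hmono, hroot⟩ := h.exists_order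
  obtain ⟨σ, h', hD', hham, hle, hsimple, hthin⟩ := h.exists_hamiltonian hD hmono hroot
  let y := Fintype.orderIsoFinOfCardEq V rfl
  refine ⟨y.toEquiv, D.permSrc σ, fun e => y.symm.strictMono (hD e), fun i j hij => ?_, h',
    fun e => y.symm.strictMono (hD' e), fun i j hij => ?_, fun x => ?_, hsimple,
    fun k hk hconn => hconn.permSrc hk hD h hD' hham hthin⟩
  · simp only [← hD.coe_pathCount]
    exact_mod_cast hmono (y.monotone hij)
  · refine hham _ _ ((apply_covBy_apply_iff y).2 ?_) (h.source_le hD _)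
    rwa [Fin.covBy_iff, Nat.covBy_iff_add_one_eq]
  · rw [← hD.coe_pathCount, ← hD'.coe_pathCount]
    exact_mod_cast hle x

theorem IsThreeRegular.two_mul_card [Fintype V] [Fintype E] {D : DiMultigraph V E}
    (h : D.IsThreeRegular) : 2 * Fintype.card E = 3 * Fintype.card V := by
  have key : ∀ φ : E → V, ∑ x, {e | φ e = x}.ncard = Fintype.card E := by
    intro φ
    rw [← Nat.card_eq_fintype_card, ← Nat.card_congr (Equiv.sigmaFiberEquiv φ), Nat.card_sigma]
    rfl
  have hsum : ∑ x, (D.indeg x + D.outdeg x) = ∑ _x : V, 3 := Finset.sum_congr rfl fun x _ => h x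
  rw [Finset.sum_add_distrib, Finset.sum_const, Finset.card_univ, smul_eq_mul] at hsum
  have h1 : ∑ x, D.indeg x = Fintype.card E := key D.tgt
  have h2 : ∑ x, D.outdeg x = Fintype.card E := key D.src
  omega

end Main

/-! ### Invariance under isomorphism. -/

section Relabel

variable {V W : Type u} {E F : Type v}

/-- The isomorphic graph with renamed vertices and edges. -/
def relabel (D : DiMultigraph W F) (φ : W ≃ V) (ψ : F ≃ E) : DiMultigraph V E :=
  ⟨fun e => φ (D.src (ψ.symm e)), fun e => φ (D.tgt (ψ.symm e))⟩

variable {D : DiMultigraph W F} {φ : W ≃ V} {ψ : F ≃ E} {s t : W}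

theorem isPath_relabel {x y : W} {l : List F} :
    (D.relabel φ ψ).IsPath (φ x) (l.map ψ) (φ y) ↔ D.IsPath x l y := by
  induction l generalizing x with
  | nil => simp [IsPath]
  | cons e l ih => simp [IsPath, ← ih, relabel]

theorem numPaths_relabel (x y : W) : (D.relabel φ ψ).numPaths (φ x) (φ y) = D.numPaths x y := by
  rw [numPaths, numPaths, ← (List.map_injective_iff.2 ψ.injective).encard_image]
  congr 1
  ext l
  obtain ⟨l, rfl⟩ := (List.map_surjective_iff.2 ψ.surjective) l
  rw [(List.map_injective_iff.2 ψ.injective).mem_set_image]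
  exact isPath_relabel

theorem ncard_preimage_symm (ψ : F ≃ E) (S : Set F) : (ψ.symm ⁻¹' S).ncard = S.ncard :=
  Set.ncard_preimage_of_injective_subset_range ψ.symm.injective (by simp)

theorem indeg_relabel (x : W) : (D.relabel φ ψ).indeg (φ x) = D.indeg x := by
  rw [indeg, indeg, ← ncard_preimage_symm ψ]
  congr 1
  ext e
  simp [relabel]

theorem outdeg_relabel (x : W) : (D.relabel φ ψ).outdeg (φ x) = D.outdeg x := by
  rw [outdeg, outdeg, ← ncard_preimage_symm ψ]
  congr 1
  ext e
  simp [relabel]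

theorem IsCubicDag.relabel (h : D.IsCubicDag s t) :
    (D.relabel φ ψ).IsCubicDag (φ s) (φ t) where
  threeRegular x := by
    obtain ⟨x, rfl⟩ := φ.surjective x
    rw [indeg_relabel, outdeg_relabel, h.threeRegular]
  acyclic x l hl := by
    obtain ⟨x, rfl⟩ := φ.surjective x
    obtain ⟨l, rfl⟩ := (List.map_surjective_iff.2 ψ.surjective) l
    rw [h.acyclic x l (isPath_relabel.1 hl), List.map_nil]
  source x := by
    obtain ⟨x, rfl⟩ := φ.surjective x
    rw [indeg_relabel, h.source, φ.apply_eq_iff_eq]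
  sink x := by
    obtain ⟨x, rfl⟩ := φ.surjective x
    rw [outdeg_relabel, h.sink, φ.apply_eq_iff_eq]

theorem EdgeConnected.relabel [Nonempty W] [Finite F] {k : ℕ} (h : D.EdgeConnected k) :
    (D.relabel φ ψ).EdgeConnected k := by
  have : Finite E := Finite.of_equiv F ψ
  have : Nonempty V := φ.nonempty_congr.1 inferInstance
  refine edgeConnected_iff.2 fun X hX hX' => ?_
  have := edgeConnected_iff.1 h (φ ⁻¹' X) (hX.preimage φ.surjective)
    (hX'.preimage φ.surjective)
  rwa [← ncard_preimage_symm ψ] at this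

theorem IsSimple.relabel (h : D.IsSimple) : (D.relabel φ ψ).IsSimple := by
  refine ⟨fun e he => h.1 _ (φ.injective he), fun e e' he => ψ.symm.injective (h.2 ?_)⟩
  exact Sym2.map.injective φ.injective he

theorem InClass.relabel [Finite F] {k : ℕ} {simple : Bool} (h : D.InClass k simple s t) :
    (D.relabel φ ψ).InClass k simple (φ s) (φ t) :=
  have : Nonempty W := ⟨s⟩
  ⟨h.1.relabel, h.2.1.relabel, fun hs => (h.2.2 hs).relabel⟩

end Relabel

instance {V : Type u} {E : Type v} [Finite V] [Finite E] : Finite (DiMultigraph V E) :=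
  Finite.of_injective (fun D => (D.src, D.tgt)) fun D D' h => by
    cases D; cases D'; simpa using h

/-- By 3-regularity the vertex number fixes the edge number, so every competitor can be moved onto
`V` and `E`, where only finitely many graphs exist. Improving a maximizer there keeps it maximal. -/
theorem exists_maximal_hamiltonian {k : ℕ} {simple : Bool} (hk : k ≤ 3)
    {V : Type u} {E : Type v} [Fintype V] [Fintype E]
    (hne : ∃ (D₀ : DiMultigraph V E) (s₀ t₀ : V), D₀.InClass k simple s₀ t₀) :
    ∃ (D' : DiMultigraph V E) (s' t' : V), D'.InClass k simple s' t' ∧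
      (∃ y, D'.IsHamiltonianPath y) ∧
      ∀ (W : Type u) (F : Type v) [Fintype W] [Fintype F] (D : DiMultigraph W F) (s t : W),
        Fintype.card W = Fintype.card V → D.InClass k simple s t →
        D.numPaths s t ≤ D'.numPaths s' t' := by
  obtain ⟨D₀, s₀, t₀, h₀⟩ := hne
  obtain ⟨⟨D, s, t⟩, h, hmax⟩ := Set.exists_max_image
    {p : DiMultigraph V E × V × V | p.1.InClass k simple p.2.1 p.2.2}
    (fun p => p.1.numPaths p.2.1 p.2.2) (Set.toFinite _) ⟨(D₀, s₀, t₀), h₀⟩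
  obtain ⟨y, D', -, -, h', -, hham, hle, hsimple, hconn⟩ := h.1.exists_hamiltonian_improvement
  refine ⟨D', s, t, ⟨h', hconn k hk h.2.1, fun hs => hsimple (h.2.2 hs)⟩, ⟨y, hham⟩, ?_⟩
  intro W F _ _ D₁ s₁ t₁ hcard h₁
  have hcard' : Fintype.card F = Fintype.card E := by
    have := h₁.1.threeRegular.two_mul_card
    have := h₀.1.threeRegular.two_mul_card
    omega
  let φ := Fintype.equivOfCardEq hcard
  let ψ := Fintype.equivOfCardEq hcard'
  rw [← numPaths_relabel (φ := φ) (ψ := ψ)]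
  exact (hmax (D₁.relabel φ ψ, φ s₁, φ t₁) h₁.relabel).trans (hle t)

end DiMultigraph

theorem mainTheorem2 :
    (∀ (V : Type u) (E : Type v) [Fintype V] [Fintype E] (D : DiMultigraph V E) (s t : V),
      D.IsCubicDag s t →
      ∃ (y : Fin (Fintype.card V) ≃ V) (D' : DiMultigraph V E),
        D.IsTopologicalOrder y ∧
        Monotone (fun i => D.numPaths s (y i)) ∧
        D'.IsCubicDag s t ∧
        D'.IsTopologicalOrder y ∧
        D'.IsHamiltonianPath y ∧
        (∀ x, D.numPaths s x ≤ D'.numPaths s x) ∧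
        (D.IsSimple → D'.IsSimple) ∧
        (D.EdgeConnected 2 → D'.EdgeConnected 2) ∧
        (D.EdgeConnected 3 → D'.EdgeConnected 3)) ∧
    (∀ (k : ℕ) (simple : Bool), 1 ≤ k → k ≤ 3 →
      ∀ (V : Type u) (E : Type v) [Fintype V] [Fintype E],
        (∃ (D₀ : DiMultigraph V E) (s₀ t₀ : V), D₀.InClass k simple s₀ t₀) →
        ∃ (D' : DiMultigraph V E) (s' t' : V),
          D'.InClass k simple s' t' ∧
          (∃ y, D'.IsHamiltonianPath y) ∧
          ∀ (W : Type u) (F : Type v) [Fintype W] [Fintype F] (D : DiMultigraph W F) (s t : W),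
            Fintype.card W = Fintype.card V → D.InClass k simple s t →
            D.numPaths s t ≤ D'.numPaths s' t') := by
  refine ⟨?_, ?_⟩
  · intro V E _ _ D s t h
    obtain ⟨y, D', h1, h2, h3, h4, h5, h6, h7, h8⟩ := h.exists_hamiltonian_improvement
    exact ⟨y, D', h1, h2, h3, h4, h5, h6, h7, h8 2 (by norm_num), h8 3 le_rfl⟩
  · intro k simple _ hk V E _ _ hne
    exact DiMultigraph.exists_maximal_hamiltonian hk hne
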